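/- Let $m\ge 1$ be an integer. For a (finite) tree $T$ and a vertex $v$ of $T$, let $a_T^{(m)}(v)$ be the number of walks in $T$ that begin and end at $v$ and traverse each edge of $T$ exactly $2m$ times, and let $\Gamma(T)$ be the automorphism group of $T$. For $n\ge 0$ define the hypergraph Catalan number $$C_n^{(m)}=\sum_{T}\sum_{v\in T}\frac{a_T^{(m)}(v)}{|\Gamma(T)|}\in\mathbb{Q},$$ where $T$ runs over the unlabeled trees (isomorphism classes of trees) on $n+1$ vertices. Let $W_m(k)$ be the number of partitions of a $k$-element set into blocks of size $m$, and let $\lambda(r,g)=\binom{r-1+g}{r-1}$ be the dimension of the space of homogeneous polynomials of degree $g$ in $r\ge 1$ variables. Put $$\ell_m(x)=\sum_{d\ge 0}W_m(dm)\,\lambda(m,dm)\,x^d,\qquad h_m(x)=\sum_{d\ge 0}W_m(dm)\,x^d .$$ Then there is a unique formal power series $f_m(x)\in\mathbb{Z}[\![x]\!]$ satisfying $$f_m(x)=x\,\ell_m(f_m(x)),$$ and with this $f_m$ the generating function $F_m(x)=\sum_{n\ge 0}C_n^{(m)}x^{n+1}$ satisfies $$F_m(x)=x\,h_m(f_m(x)).$$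 -/

import Mathlib

open scoped PowerSeries

noncomputable section

namespace HypergraphCatalan

/-! ### Tours on trees -/

/-- An `m`-tour of the graph `G` beginning at `v`: a walk that begins and ends at `v` and
traverses each edge of `G` exactly `2 * m` times. -/
def Tour {V : Type*} [DecidableEq V] (G : SimpleGraph V) (m : ℕ) (v : V) : Type _ :=
  {w : G.Walk v v // ∀ e ∈ G.edgeSet, w.edges.count e = 2 * m}

/-- The number `a_G^{(m)}(v)` of `m`-tours of `G` beginning at `v`. -/
def tourCount {V : Type*} [DecidableEq V] (G : SimpleGraph V) (m : ℕ) (v : V) : ℕ :=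
  Nat.card (Tour G m v)

/-- A graph isomorphism transports tours. -/
def Tour.map {V V' : Type*} [DecidableEq V] [DecidableEq V'] {G : SimpleGraph V}
    {G' : SimpleGraph V'} (φ : G ≃g G') {m : ℕ} {v : V} (w : Tour G m v) :
    Tour G' m (φ v) :=
  ⟨w.1.map φ.toHom, by
    intro e he
    have hinj : Function.Injective (Sym2.map φ) := Sym2.map.injective φ.injective
    obtain ⟨e₀, he₀, rfl⟩ : ∃ e₀ ∈ G.edgeSet, Sym2.map φ e₀ = e := by
      induction e with
      | _ a b =>
        refine ⟨s(φ.symm a, φ.symm b), ?_, by simp⟩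
        simpa using φ.symm.map_adj_iff.2 he
    rw [SimpleGraph.Walk.edges_map]
    exact (List.count_map_of_injective _ _ hinj _).trans (w.2 e₀ he₀)⟩

theorem Tour.map_injective {V V' : Type*} [DecidableEq V] [DecidableEq V'] {G : SimpleGraph V}
    {G' : SimpleGraph V'} (φ : G ≃g G') {m : ℕ} {v : V} :
    Function.Injective (Tour.map φ : Tour G m v → Tour G' m (φ v)) := by
  intro w w' h
  apply Subtype.ext
  exact SimpleGraph.Walk.map_injective_of_injective (f := φ.toHom) φ.injective v v
    (congrArg Subtype.val h)

theorem tourCount_iso {V V' : Type*} [DecidableEq V] [DecidableEq V']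
    {G : SimpleGraph V} {G' : SimpleGraph V'} (φ : G ≃g G') (m : ℕ) (v : V) :
    tourCount G m v = tourCount G' m (φ v) := by
  have hback : ∃ g : Tour G' m (φ v) → Tour G m v, Function.Injective g := by
    have h : ∃ g : Tour G' m (φ v) → Tour G m (φ.symm (φ v)), Function.Injective g :=
      ⟨_, Tour.map_injective φ.symm⟩
    rwa [RelIso.symm_apply_apply] at h
  obtain ⟨g, hg⟩ := hback
  obtain ⟨e⟩ := Function.Embedding.antisymm ⟨_, Tour.map_injective (m := m) (v := v) φ⟩ ⟨g, hg⟩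
  exact Nat.card_congr e

/-! ### Unlabeled trees and the hypergraph Catalan numbers -/

/-- Isomorphism of trees with vertex set `Fin k`. -/
def treeSetoid (k : ℕ) : Setoid {G : SimpleGraph (Fin k) // G.IsTree} where
  r G H := Nonempty (G.1 ≃g H.1)
  iseqv :=
    ⟨fun _ => ⟨RelIso.refl _⟩, fun ⟨φ⟩ => ⟨φ.symm⟩, fun ⟨φ⟩ ⟨ψ⟩ => ⟨φ.trans ψ⟩⟩

/-- Unlabeled trees on `k` vertices: isomorphism classes of trees with `k` vertices. -/
def UnlabeledTree (k : ℕ) : Type := Quotient (treeSetoid k)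

instance (k : ℕ) : Finite (UnlabeledTree k) :=
  inferInstanceAs (Finite (Quotient (treeSetoid k)))

instance (k : ℕ) : Fintype (UnlabeledTree k) := Fintype.ofFinite _

/-- The sum `∑_v a_G^{(m)}(v) / |Γ(G)|`, where `Γ(G)` is the automorphism group of `G`. -/
def graphWeight {k : ℕ} (m : ℕ) (G : SimpleGraph (Fin k)) : ℚ :=
  ∑ v : Fin k, (tourCount G m v : ℚ) / (Nat.card (G ≃g G) : ℚ)

theorem graphWeight_iso {k : ℕ} (m : ℕ) {G H : SimpleGraph (Fin k)} (φ : G ≃g H) :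
    graphWeight m G = graphWeight m H := by
  have hc : Nat.card (G ≃g G) = Nat.card (H ≃g H) :=
    Nat.card_congr
      { toFun := fun α => (φ.symm.trans α).trans φ
        invFun := fun β => (φ.trans β).trans φ.symm
        left_inv := fun α => by ext x; simp
        right_inv := fun β => by ext x; simp }
  unfold graphWeight
  rw [hc]
  refine Fintype.sum_equiv φ.toEquiv _ _ fun v => ?_
  rw [tourCount_iso φ m v]
  rfl

/-- The contribution `∑_v a_T^{(m)}(v) / |Γ(T)|` of an unlabeled tree `T`. -/
def UnlabeledTree.weight {k : ℕ} (m : ℕ) (T : UnlabeledTree k) : ℚ :=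
  Quotient.lift (s := treeSetoid k) (fun G => graphWeight m G.1)
    (fun _ _ ⟨φ⟩ => graphWeight_iso m φ) T

/-- The hypergraph Catalan number `C_n^{(m)}`: the sum over all unlabeled trees `T` on `n + 1`
vertices of `∑_{v ∈ T} a_T^{(m)}(v) / |Γ(T)|`. -/
def hyperCatalan (m n : ℕ) : ℚ :=
  ∑ T : UnlabeledTree (n + 1), T.weight m

/-! ### The generating functions -/

/-- `W_m(k)`: the number of partitions of a `k`-element set into blocks of size `m`. -/
def blockPartitions (m k : ℕ) : ℕ :=
  Nat.card {P : Finpartition (Finset.univ : Finset (Fin k)) // ∀ B ∈ P.parts, B.card = m}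

/-- `λ(r, g)`: the dimension of the space of homogeneous polynomials of degree `g` in `r`
variables. -/
def homogDim (r g : ℕ) : ℕ :=
  Module.finrank ℚ (MvPolynomial.homogeneousSubmodule (Fin r) ℚ g)

/-- For `r ≥ 1`, `λ(r, g)` is the binomial coefficient `(r - 1 + g).choose (r - 1)`. -/
theorem homogDim_eq_choose (r g : ℕ) (hr : 1 ≤ r) :
    homogDim r g = (r - 1 + g).choose (r - 1) := by
  have h : homogDim r g = Nat.card {d : Fin r →₀ ℕ | d.degree = g} := by
    unfold homogDim
    rw [MvPolynomial.homogeneousSubmodule_eq_finsupp_supported]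
    exact Module.finrank_eq_nat_card_basis
      (MvPolynomial.basisRestrictSupport ℚ {d : Fin r →₀ ℕ | d.degree = g})
  have h' : {d : Fin r →₀ ℕ | d.degree = g} =
      ((Finset.univ : Finset (Fin r)).finsuppAntidiag g : Set (Fin r →₀ ℕ)) := by
    ext d
    simp [Finsupp.degree_eq_sum]
  rw [h, h', Nat.card_coe_set_eq, Set.ncard_coe_finset, Finset.card_finsuppAntidiag_nat_eq_choose,
    Finset.card_univ, Fintype.card_fin]
  obtain ⟨k, rfl⟩ : ∃ k, r = k + 1 := ⟨r - 1, by omega⟩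
  rw [show k + 1 + g - 1 = k + g by omega, show k + 1 - 1 = k by omega]
  exact (Nat.choose_symm_add).symm

/-- `ℓ_m(x) = ∑_{d ≥ 0} W_m(dm) λ(m, dm) x^d`. -/
def ell (m : ℕ) : ℤ⟦X⟧ :=
  PowerSeries.mk fun d => (blockPartitions m (d * m) : ℤ) * (homogDim m (d * m) : ℤ)

/-- `h_m(x) = ∑_{d ≥ 0} W_m(dm) x^d`. -/
def hSeries (m : ℕ) : ℤ⟦X⟧ :=
  PowerSeries.mk fun d => (blockPartitions m (d * m) : ℤ)

/-- The coefficients of `F_m`: `0` in degree `0`, and `C_n^{(m)}` in degree `n + 1`. -/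
def catalanCoeff (m : ℕ) : ℕ → ℚ
  | 0 => 0
  | n + 1 => hyperCatalan m n

/-- `F_m(x) = ∑_{n ≥ 0} C_n^{(m)} x^{n+1}`. -/
def catalanSeries (m : ℕ) : ℚ⟦X⟧ :=
  PowerSeries.mk (catalanCoeff m)

end HypergraphCatalan

end

/-! The proof reduces everything to the identity `F = X + f ^ 2`.

On the side of `h`: fixing a point and choosing its block shows that `λ(m, dm) * W_m(dm) =
W_m((d+1)m)`. So the coefficients of `ℓ` are those of `h` shifted by one, `h = 1 + X * ℓ`, and `X *
h(f) = X + f * (X * ℓ(f)) = X + f ^ 2`.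

On the side of trees: a tour of a tree with an extra leaf at `j` is a tour of the smaller tree with
`m` excursions to the leaf distributed among the visits to `j` (`walkCount_addLeaf`). Removing
leaves one at a time gives, for a tree with at least two vertices, `deg v * ∏ u, e (deg u - 1)`
tours from `v`, where `e d = d! * [X ^ d] ℓ` (`tourCount_eq`, `exitCount_eq`). Summing over `v`
replaces `deg v` by twice the number of edges.

By orbit counting, `(n+2)! * C_{n+1}` is the sum of these numbers over labeled trees on `n + 2`
vertices (`hyperCatalan_mul_factorial`). There are `n! / ∏ d_v!` labeled trees with degrees `d_v +
1` (`treeCount_mul_prod_factorial`), so the sum is `2(n+1) * n! * [X ^ n] ℓ ^ (n+2)`. Lagrange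
inversion identifies `2/(n+2) * [X ^ n] ℓ ^ (n+2)` with `[X ^ (n+2)] f ^ 2`; the one-vertex tree
supplies the term `X`. -/

section LagrangeInversion

/-! ### Compositional inverses and Lagrange inversion for formal power series. -/

open PowerSeries

variable {R : Type*} [CommRing R]

/-- The fixed points of `f ↦ X * ℓ(f)` are the right inverses of `X / ℓ` under substitution. -/
theorem PowerSeries.eq_X_mul_subst_iff {l q f : R⟦X⟧} (hlq : l * q = 1) :
    f = X * subst f l ↔ constantCoeff f = 0 ∧ subst f (X * q) = X := by
  have key : ∀ hf : HasSubst f, subst f l * subst f q = 1 := fun hf => by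
    rw [← subst_mul hf, hlq, ← coe_substAlgHom hf, map_one]
  constructor
  · intro h
    have h0 : constantCoeff f = 0 := by rw [h]; simp
    have hf : HasSubst f := HasSubst.of_constantCoeff_zero' h0
    refine ⟨h0, ?_⟩
    rw [subst_mul hf, subst_X hf]
    nth_rw 1 [h]
    rw [mul_assoc, key hf, mul_one]
  · rintro ⟨h0, h⟩
    have hf : HasSubst f := HasSubst.of_constantCoeff_zero' h0
    rw [subst_mul hf, subst_X hf] at h
    rw [← h, mul_assoc, mul_comm (subst f q), key hf, mul_one]

theorem PowerSeries.exists_subst_inverse {l q : R⟦X⟧} (hlq : l * q = 1) :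
    ∃ f : R⟦X⟧, constantCoeff f = 0 ∧ subst f (X * q) = X ∧ subst (X * q) f = X := by
  have h0 : constantCoeff (X * q) = 0 := by simp
  have h1 : IsUnit (coeff 1 (X * q)) := by
    rw [show (1 : ℕ) = 0 + 1 from rfl, coeff_succ_X_mul, coeff_zero_eq_constantCoeff_apply]
    exact IsUnit.of_mul_eq_one_right (constantCoeff l) (by rw [← map_mul, hlq, map_one])
  exact ⟨substInvOfIsUnit _ h1, by simp, subst_substInvOfIsUnit_right _ h0 h1,
    subst_substInvOfIsUnit_left _ h0 h1⟩

/-- Composition is associative, so a right inverse `f` and a left inverse `g` of `p` agree: `f = g ∘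
p ∘ f = g`. -/
theorem PowerSeries.eq_of_subst_eq_X {p f g : R⟦X⟧} (hp : constantCoeff p = 0)
    (hf : constantCoeff f = 0) (h : subst f p = X) (h' : subst p g = X) : f = g := by
  have hf' : HasSubst f := HasSubst.of_constantCoeff_zero' hf
  have hp' : HasSubst p := HasSubst.of_constantCoeff_zero' hp
  calc f = subst f (X : R⟦X⟧) := (subst_X hf').symm
    _ = g := by rw [← h', subst_comp_subst_apply hp' hf', h, ← map_algebraMap_eq_subst_X]; simp

theorem PowerSeries.existsUnique_eq_X_mul_subst {l : R⟦X⟧} (hl : constantCoeff l = 1) :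
    ∃! f : R⟦X⟧, f = X * subst f l := by
  have hlq := mul_invOfUnit l 1 (by simpa using hl)
  obtain ⟨g, hg0, hg, hg'⟩ := exists_subst_inverse hlq
  refine ⟨g, (eq_X_mul_subst_iff hlq).2 ⟨hg0, hg⟩, fun f hf => ?_⟩
  obtain ⟨hf0, hf⟩ := (eq_X_mul_subst_iff hlq).1 hf
  exact eq_of_subst_eq_X (by simp) hf0 hf hg'

/-- With `p = X * q = X / l`, this coefficient is the residue of `p' / p ^ (n + 1)`. For `n ≠ 0`
that is, up to the factor `-n`, the residue of the derivative of `p ^ (-n)`, hence zero.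
Torsion-freeness allows that factor to be cancelled. -/
theorem PowerSeries.coeff_derivative_X_mul_inverse_mul_pow [IsAddTorsionFree R] {l q : R⟦X⟧}
    (hlq : l * q = 1) (n : ℕ) :
    coeff n (derivative R (X * q) * l ^ (n + 1)) = if n = 0 then 1 else 0 := by
  have hD : derivative R (X * q) = q + X * derivative R q := by
    rw [Derivation.leibniz]; simp [add_comm]
  have hq : l * derivative R q + q * derivative R l = 0 := by
    have := congrArg (derivative R) hlq
    rw [Derivation.leibniz] at this
    simpa using this
  cases n with
  | zero =>
    have : constantCoeff q * constantCoeff l = 1 := by rw [← map_mul, mul_comm, hlq, map_one]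
    simp [hD, this]
  | succ n =>
    have h1 : derivative R (X * q) * l ^ (n + 1 + 1) =
        l ^ (n + 1) - X * (l ^ n * derivative R l) := by
      rw [hD]
      linear_combination (l ^ (n + 1) - X * l ^ n * derivative R l) * hlq +
        X * l ^ (n + 1) * hq
    have h2 : ((n + 1 : ℕ) : R⟦X⟧) * (l ^ n * derivative R l) = derivative R (l ^ (n + 1)) := by
      rw [derivative_pow]; simp [mul_assoc]
    rw [h1, if_neg (by omega)]
    refine (nsmul_right_injective (n := n + 1) (by omega)) ?_
    simp only [smul_zero]
    rw [← map_nsmul, smul_sub, map_sub, nsmul_eq_mul, nsmul_eq_mul (n + 1) (X * _),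
      mul_left_comm, h2, coeff_succ_X_mul, coeff_derivative, ← nsmul_eq_mul, map_nsmul,
      nsmul_eq_mul, mul_comm]
    push_cast
    ring

/-- Change of variables `x = p(t)`, `p = X * q`, in the residue of `g / x ^ (n + 1)`. The induction
writes `g = X * g₁ + c`: the constant is handled by the preceding residue, and `p * l = X` lowers
the order for `g₁`. -/
theorem PowerSeries.coeff_subst_mul_derivative_mul_pow [IsAddTorsionFree R] {l q : R⟦X⟧}
    (hlq : l * q = 1) (n : ℕ) (g : R⟦X⟧) :
    coeff n (subst (X * q) g * derivative R (X * q) * l ^ (n + 1)) = coeff n g := by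
  have hs : HasSubst (X * q) := HasSubst.of_constantCoeff_zero' (by simp)
  induction n generalizing g with
  | zero =>
    have h := coeff_derivative_X_mul_inverse_mul_pow hlq 0
    have h3 : constantCoeff (subst (X * q) g) = constantCoeff g := by
      conv_lhs => rw [eq_X_mul_shift_add_const g]
      rw [subst_add hs, subst_mul hs, subst_X hs, subst_C]
      simp only [map_add, map_mul, constantCoeff_X, zero_mul, zero_add]
      exact constantCoeff_C _
    rw [mul_assoc]
    simp only [coeff_zero_eq_constantCoeff, map_mul] at h ⊢
    rw [h, h3]; simp
  | succ n ih =>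
    have h := coeff_derivative_X_mul_inverse_mul_pow hlq (n + 1)
    rw [if_neg (by omega)] at h
    conv_lhs => rw [eq_X_mul_shift_add_const g]
    rw [subst_add hs, subst_mul hs, subst_X hs, subst_C]
    have : (X * q * subst (X * q) (mk fun p => coeff (p + 1) g) + MvPowerSeries.C (constantCoeff g))
        * derivative R (X * q) * l ^ (n + 1 + 1) =
        X * (subst (X * q) (mk fun p => coeff (p + 1) g) * derivative R (X * q) * l ^ (n + 1))
        + C (constantCoeff g) * (derivative R (X * q) * l ^ (n + 1 + 1)) := by
      change (X * q * subst (X * q) (mk fun p => coeff (p + 1) g) + C (constantCoeff g))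
        * derivative R (X * q) * l ^ (n + 1 + 1) = _
      linear_combination X * (subst (X * q) (mk fun p => coeff (p + 1) g)) *
        derivative R (X * q) * l ^ (n + 1) * hlq
    rw [this, map_add, coeff_succ_X_mul, ih, coeff_C_mul, h]
    simp

/-- Lagrange inversion for powers: if `f = X * ℓ(f)` then
`(n + k) [X ^ (n + k)] f ^ k = k [X ^ n] ℓ ^ (n + k)`. -/
theorem PowerSeries.lagrange_inversion_pow [IsAddTorsionFree R] {l f : R⟦X⟧}
    (hl : constantCoeff l = 1) (hf : f = X * subst f l) (n k : ℕ) :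
    ((n + k + 1 : ℕ) : R) * coeff (n + k + 1) (f ^ (k + 1)) =
      ((k + 1 : ℕ) : R) * coeff n (l ^ (n + k + 1)) := by
  have hlq := mul_invOfUnit l 1 (by simpa using hl)
  set q := invOfUnit l 1
  have hs : HasSubst (X * q) := HasSubst.of_constantCoeff_zero' (by simp)
  obtain ⟨g, hg0, hg, hg'⟩ := exists_subst_inverse hlq
  obtain ⟨hf0, hf'⟩ := (eq_X_mul_subst_iff hlq).1 hf
  obtain rfl : f = g := eq_of_subst_eq_X (by simp) hf0 hf' hg'
  -- Since `f ∘ p = X` for `p = X * q`, the chain rule turns the substituted derivative into `(X ^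
  -- (k + 1))' = (k + 1) X ^ k`.
  have h := coeff_subst_mul_derivative_mul_pow hlq (n + k) (derivative R (f ^ (k + 1)))
  rw [← derivative_subst hs, subst_pow hs, hg', coeff_derivative, derivative_pow, derivative_X,
    add_tsub_cancel_right, mul_one, mul_assoc, ← nsmul_eq_mul, map_nsmul, coeff_X_pow_mul] at h
  rw [nsmul_eq_mul] at h
  rw [h]
  push_cast
  ring

end LagrangeInversion

noncomputable section

namespace HypergraphCatalan

/-! ### Partitions into blocks of size `m` -/

section BlockPartitions

variable {α : Type*} [DecidableEq α]

/-- Partitions of `s` into blocks of size `m`. -/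
abbrev BlockPartition (m : ℕ) (s : Finset α) : Type _ :=
  {P : Finpartition s // ∀ B ∈ P.parts, B.card = m}

theorem sdiff_eq_of_mem_parts {s : Finset α} {P : Finpartition s} {B D : Finset α}
    (hD : D ∈ P.parts) (hB : B ∈ P.parts) (h : D ≠ B) : D \ B = D :=
  Finset.sdiff_eq_self_of_disjoint (P.disjoint hD hB h)

/-- A partition of `s` into blocks of size `m` amounts to the block of `a ∈ s` and a partition of
the complement of that block. -/
def blockPartitionEquiv {m : ℕ} {s : Finset α} {a : α} (ha : a ∈ s) :
    BlockPartition m s ≃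
      Σ B : {B : Finset α // B ⊆ s ∧ a ∈ B ∧ B.card = m}, BlockPartition m (s \ B.1) where
  toFun P := ⟨⟨P.1.part a, P.1.part_subset a, P.1.mem_part_self.2 ha,
      P.2 _ (P.1.part_mem.2 ha)⟩, ⟨P.1.avoid (P.1.part a), fun B hB => by
        obtain ⟨D, hD, hDa, rfl⟩ := (Finpartition.mem_avoid _).1 hB
        have hne : D ≠ P.1.part a := fun h => hDa h.le
        rw [sdiff_eq_of_mem_parts hD (P.1.part_mem.2 ha) hne]
        exact P.2 D hD⟩⟩
  invFun Q := ⟨Q.2.1.extend (b := Q.1.1) (c := s)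
      (Finset.nonempty_iff_ne_empty.1 ⟨a, Q.1.2.2.1⟩) Finset.sdiff_disjoint
      (by simpa using Q.1.2.1), fun B hB => by
        rcases Finset.mem_insert.1 hB with rfl | hB
        · exact Q.1.2.2.2
        · exact Q.2.2 B hB⟩
  left_inv P := by
    apply Subtype.ext
    apply Finpartition.ext
    ext B
    simp only [Finpartition.extend, Finset.mem_insert, Finpartition.mem_avoid]
    constructor
    · rintro (rfl | ⟨D, hD, hDa, rfl⟩)
      · exact P.1.part_mem.2 ha
      · have hne : D ≠ P.1.part a := fun h => hDa h.le
        rwa [sdiff_eq_of_mem_parts hD (P.1.part_mem.2 ha) hne]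
    · intro hB
      by_cases h : B = P.1.part a
      · exact Or.inl h
      · have hd := P.1.disjoint hB (P.1.part_mem.2 ha) h
        refine Or.inr ⟨B, hB, fun hle => ?_, Finset.sdiff_eq_self_of_disjoint hd⟩
        exact P.1.ne_bot hB (le_bot_iff.1 (hd le_rfl hle))
  right_inv := by
    rintro ⟨⟨B, hBs, haB, hBm⟩, ⟨Q, hQ⟩⟩
    have hpart : ∀ h1 h2 h3, (Q.extend (b := B) (c := s) h1 h2 h3).part a = B := by
      intro h1 h2 h3
      exact Finpartition.part_eq_of_mem _ (Finset.mem_insert_self _ _) haB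
    -- The second components have types depending on the block; generalizing the block to `C` and
    -- substituting `C = B` leaves only an equality of sets of parts.
    have key : ∀ (C : Finset α) (hC : C = B) (h1 : C ⊆ s ∧ a ∈ C ∧ C.card = m)
        (R : BlockPartition m (s \ C)), R.1.parts = Q.parts →
        (⟨⟨C, h1⟩, R⟩ : Σ B : {B : Finset α // B ⊆ s ∧ a ∈ B ∧ B.card = m},
          BlockPartition m (s \ B.1)) = ⟨⟨B, hBs, haB, hBm⟩, ⟨Q, hQ⟩⟩ := by
      rintro C rfl h1 R hR
      have : R = ⟨Q, hQ⟩ := Subtype.ext (Finpartition.ext hR)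
      rw [this]
    refine key _ (hpart (Finset.nonempty_iff_ne_empty.1 ⟨a, haB⟩) Finset.sdiff_disjoint
      (by simpa using hBs)) _ _ ?_
    ext D
    simp only [Finpartition.mem_avoid, hpart]
    have hsub : ∀ E ∈ Q.parts, Disjoint E B := fun E hE =>
      Finset.disjoint_of_subset_left (Q.le hE) Finset.sdiff_disjoint
    constructor
    · rintro ⟨E, hE, hEB, rfl⟩
      rcases Finset.mem_insert.1 hE with rfl | hE
      · exact absurd le_rfl hEB
      · rwa [Finset.sdiff_eq_self_of_disjoint (hsub E hE)]
    · intro hD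
      refine ⟨D, Finset.mem_insert_of_mem hD, fun hle => ?_,
        Finset.sdiff_eq_self_of_disjoint (hsub D hD)⟩
      exact Q.ne_bot hD (le_bot_iff.1 (hsub D hD le_rfl hle))

theorem card_subsets_containing {s : Finset α} {a : α} (ha : a ∈ s) (m : ℕ) :
    Nat.card {B : Finset α // B ⊆ s ∧ a ∈ B ∧ B.card = m + 1} = (s.card - 1).choose m := by
  rw [← Finset.card_erase_of_mem ha, ← Finset.card_powersetCard, ← Nat.card_eq_finsetCard]
  refine Nat.card_congr
    { toFun := fun B => ⟨B.1.erase a, Finset.mem_powersetCard.2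
        ⟨Finset.erase_subset_erase a B.2.1, by
          rw [Finset.card_erase_of_mem B.2.2.1, B.2.2.2]; rfl⟩⟩
      invFun := fun C => ⟨insert a C.1, ?_⟩
      left_inv := fun B => Subtype.ext (Finset.insert_erase B.2.2.1)
      right_inv := fun C => Subtype.ext (Finset.erase_insert ?_) }
  · obtain ⟨C, hC⟩ := C
    obtain ⟨h1, h2⟩ := Finset.mem_powersetCard.1 hC
    have hna : a ∉ C := fun h => (Finset.mem_erase.1 (h1 h)).1 rfl
    exact ⟨Finset.insert_subset ha (h1.trans (Finset.erase_subset _ _)),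
      Finset.mem_insert_self _ _, by rw [Finset.card_insert_of_notMem hna, h2]⟩
  · exact fun h => (Finset.mem_erase.1 ((Finset.mem_powersetCard.1 C.2).1 h)).1 rfl

/-- The number of partitions of a `d * (m + 1)`-element set into blocks of size `m + 1`. -/
def blockNumber (m : ℕ) : ℕ → ℕ
  | 0 => 1
  | d + 1 => (d * (m + 1) + m).choose m * blockNumber m d

/-- The block of a fixed point is completed by `m` of the other points, and the rest is partitioned
inductively. -/
theorem card_blockPartition (m d : ℕ) (s : Finset α) (hs : s.card = d * (m + 1)) :
    Nat.card (BlockPartition (m + 1) s) = blockNumber m d := by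
  induction d generalizing s with
  | zero =>
    obtain rfl : s = ∅ := by simpa using hs
    have : Unique (BlockPartition (m + 1) (∅ : Finset α)) :=
      { default := ⟨Finpartition.empty _, by simp [Finpartition.empty]⟩
        uniq := fun P => Subtype.ext (Subsingleton.elim (α := Finpartition (⊥ : Finset α)) _ _) }
    rw [Nat.card_unique]; rfl
  | succ d ih =>
    have hpos : 0 < s.card := by rw [hs]; positivity
    obtain ⟨a, ha⟩ := Finset.card_pos.1 hpos
    have hfin : Finite {B : Finset α // B ⊆ s ∧ a ∈ B ∧ B.card = m + 1} :=
      Set.Finite.subset (s.powerset.finite_toSet) (fun B hB => by simpa using hB.1)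
    have := Fintype.ofFinite {B : Finset α // B ⊆ s ∧ a ∈ B ∧ B.card = m + 1}
    rw [Nat.card_congr (blockPartitionEquiv ha), Nat.card_sigma,
      Finset.sum_congr rfl fun B _ => ih _ ?_, Finset.sum_const, Finset.card_univ,
      ← Nat.card_eq_fintype_card, card_subsets_containing ha, smul_eq_mul, hs, blockNumber]
    · congr 2
      rw [add_mul]; omega
    · rw [Finset.card_sdiff_of_subset B.2.1, hs, B.2.2.2, add_mul]; omega

theorem blockPartitions_eq (m d : ℕ) : blockPartitions (m + 1) (d * (m + 1)) = blockNumber m d :=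
  card_blockPartition m d _ (by simp)

end BlockPartitions

theorem coeff_hSeries (m d : ℕ) :
    PowerSeries.coeff d (hSeries (m + 1)) = (blockNumber m d : ℤ) := by
  simp [hSeries, blockPartitions_eq]

/-- The dimension `homogDim (m + 1) (d * (m + 1))` is exactly the binomial coefficient by which
`blockNumber` grows from `d` to `d + 1`. -/
theorem coeff_ell (m d : ℕ) :
    PowerSeries.coeff d (ell (m + 1)) = (blockNumber m (d + 1) : ℤ) := by
  simp only [ell, PowerSeries.coeff_mk, blockPartitions_eq, homogDim_eq_choose (m + 1) _ (by omega),
    blockNumber, add_tsub_cancel_right, Nat.cast_mul]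
  rw [mul_comm, add_comm m]

theorem hSeries_eq (m : ℕ) : hSeries (m + 1) = 1 + PowerSeries.X * ell (m + 1) := by
  ext d
  cases d with
  | zero => rw [coeff_hSeries]; simp [blockNumber]
  | succ d =>
    rw [coeff_hSeries, map_add, PowerSeries.coeff_succ_X_mul, coeff_ell]
    simp [PowerSeries.coeff_one]

theorem constantCoeff_ell (m : ℕ) : PowerSeries.constantCoeff (ell (m + 1)) = 1 := by
  rw [← PowerSeries.coeff_zero_eq_constantCoeff_apply, coeff_ell]
  simp [blockNumber]

/-- The number of ways in which an `(m + 1)`-tour can leave a vertex, other than its beginning,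
with `d` children. -/
def exitCount (m : ℕ) : ℕ → ℕ
  | 0 => 1
  | d + 1 => exitCount m d * Nat.multichoose ((d + 1) * (m + 1)) (m + 1)

/-- The multiset coefficient in `exitCount` is `d + 1` times the binomial coefficient in
`blockNumber`; these extra factors build up `d!`. -/
theorem exitCount_eq (m d : ℕ) : exitCount m d = d.factorial * blockNumber m (d + 1) := by
  induction d with
  | zero => simp [exitCount, blockNumber]
  | succ d ih =>
    rw [exitCount, ih, blockNumber.eq_2 m (d + 1), Nat.factorial_succ, Nat.multichoose_eq]
    have h := Nat.choose_succ_right_eq ((d + 1) * (m + 1) + m) m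
    rw [Nat.add_sub_cancel] at h
    have h' : ((d + 1) * (m + 1) + m).choose (m + 1) = (d + 1) * ((d + 1) * (m + 1) + m).choose m :=
      Nat.eq_of_mul_eq_mul_right (show 0 < m + 1 by omega) (by rw [h]; ring)
    rw [show (d + 1) * (m + 1) + (m + 1) - 1 = (d + 1) * (m + 1) + m by omega, h']
    ring

/-- The number of ways in which an `(m + 1)`-tour can leave the vertex at which it begins, if that
vertex has degree `d`. -/
def rootExitCount (m : ℕ) : ℕ → ℕ
  | 0 => 1
  | d + 1 => rootExitCount m d * Nat.multichoose (d * (m + 1) + 1) (m + 1)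

/-- The extra visit to the beginning of a tour costs only a factor equal to its degree, so all
vertices can be given the same local weight. -/
theorem rootExitCount_succ (m d : ℕ) : rootExitCount m (d + 1) = (d + 1) * exitCount m d := by
  induction d with
  | zero => simp [rootExitCount, exitCount]
  | succ d ih =>
    rw [rootExitCount, ih, exitCount, Nat.multichoose_eq, Nat.multichoose_eq]
    have h := Nat.choose_mul_succ_eq ((d + 1) * (m + 1) + m) (m + 1)
    have h' : (d + 1) * ((d + 1) * (m + 1) + m + 1).choose (m + 1) =
        (d + 1 + 1) * ((d + 1) * (m + 1) + m).choose (m + 1) := by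
      refine Nat.eq_of_mul_eq_mul_right (show 0 < m + 1 by omega) ?_
      rw [show (d + 1) * (m + 1) + m + 1 - (m + 1) = (d + 1) * (m + 1) by omega] at h
      rw [mul_right_comm, mul_comm, ← mul_comm, mul_comm ((d + 1) * (m + 1)), ← h]
      ring
    rw [show (d + 1) * (m + 1) + 1 + (m + 1) - 1 = (d + 1) * (m + 1) + m + 1 by omega,
      show (d + 1) * (m + 1) + (m + 1) - 1 = (d + 1) * (m + 1) + m by omega,
      mul_right_comm, h']
    ring

/-! ### Walks with prescribed edges -/

section WalkCount

variable {V : Type*} [DecidableEq V]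

/-- The number of walks from `u` to `v` whose multiset of edges is `E`. -/
def walkCount (G : SimpleGraph V) (u v : V) (E : Multiset (Sym2 V)) : ℕ :=
  Nat.card {w : G.Walk u v // (w.edges : Multiset (Sym2 V)) = E}

/-- A walk is either trivial or consists of a first step and a walk. -/
def walkEquiv (G : SimpleGraph V) (u v : V) (E : Multiset (Sym2 V)) :
    {w : G.Walk u v // (w.edges : Multiset (Sym2 V)) = E} ≃
      PLift (u = v ∧ E = 0) ⊕ Σ x : {x // G.Adj u x ∧ s(u, x) ∈ E},
        {w : G.Walk x v // (w.edges : Multiset (Sym2 V)) = E.erase s(u, x)} :=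
  .symm <| .ofBijective
    (Sum.elim
      (fun h => ⟨(SimpleGraph.Walk.nil : G.Walk u u).copy rfl h.down.1, by simp [h.down.2]⟩)
      (fun p => ⟨.cons p.1.2.1 p.2.1, by
        rw [SimpleGraph.Walk.edges_cons, ← Multiset.cons_coe, p.2.2,
          Multiset.cons_erase p.1.2.2]⟩)) (by
    constructor
    · rintro (⟨h1, h2⟩ | ⟨⟨x, hx⟩, ⟨p, hp⟩⟩) (⟨h3, h4⟩ | ⟨⟨y, hy⟩, ⟨q, hq⟩⟩) h
      · rfl
      · subst h1
        simp at h
      · subst h3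
        simp at h
      · simp only [Sum.elim_inr, Subtype.mk.injEq, SimpleGraph.Walk.cons.injEq] at h
        obtain ⟨rfl, h⟩ := h
        obtain rfl := eq_of_heq h
        rfl
    · rintro ⟨w, rfl⟩
      cases w with
      | nil => exact ⟨.inl ⟨rfl, rfl⟩, rfl⟩
      | cons h p => exact ⟨.inr ⟨⟨_, h, by simp⟩, ⟨p, by simp⟩⟩, rfl⟩)

variable [Fintype V]

theorem finite_walk (G : SimpleGraph V) (u v : V) (E : Multiset (Sym2 V)) :
    Finite {w : G.Walk u v // (w.edges : Multiset (Sym2 V)) = E} := by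
  induction h : E.card generalizing E u with
  | zero =>
    obtain rfl := Multiset.card_eq_zero.1 h
    have : IsEmpty {x // G.Adj u x ∧ s(u, x) ∈ (0 : Multiset (Sym2 V))} :=
      ⟨fun x => by simpa using x.2.2⟩
    exact Finite.of_equiv _ (walkEquiv G u v 0).symm
  | succ n ih =>
    have (x : {x // G.Adj u x ∧ s(u, x) ∈ E}) :
        Finite {w : G.Walk x v // (w.edges : Multiset (Sym2 V)) = E.erase s(u, x)} :=
      ih x _ (by rw [Multiset.card_erase_of_mem x.2.2, h]; rfl)
    exact Finite.of_equiv _ (walkEquiv G u v E).symm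

open scoped Classical in
theorem walkCount_rec (G : SimpleGraph V) (u v : V) (E : Multiset (Sym2 V)) :
    walkCount G u v E = (if u = v ∧ E = 0 then 1 else 0) +
      ∑ x, if G.Adj u x ∧ s(u, x) ∈ E then walkCount G x v (E.erase s(u, x)) else 0 := by
  have := fun x => finite_walk G x v (E.erase s(u, x))
  rw [walkCount, Nat.card_congr (walkEquiv G u v E), Nat.card_sum, Nat.card_sigma,
    ← Finset.sum_filter, Finset.sum_subtype (p := fun x => G.Adj u x ∧ s(u, x) ∈ E) _ (by simp)]
  congr 1
  split_ifs with h
  · have : Unique (PLift (u = v ∧ E = 0)) := ⟨⟨⟨h⟩⟩, fun _ => rfl⟩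
    exact Nat.card_unique
  · have : IsEmpty (PLift (u = v ∧ E = 0)) := ⟨fun x => h x.down⟩
    exact Nat.card_of_isEmpty

end WalkCount

/-! ### Adding a leaf -/

section AddLeaf

variable {V : Type*}

/-- The graph obtained from `T` by adding a leaf `none` adjacent to `j`. -/
def addLeaf (T : SimpleGraph V) (j : V) : SimpleGraph (Option V) where
  Adj
    | some a, some b => T.Adj a b
    | none, some b => b = j
    | some a, none => a = j
    | none, none => False
  symm := ⟨by
    rintro (_ | a) (_ | b) h
    · exact h
    · exact h
    · exact h
    · exact SimpleGraph.Adj.symm (G := T) h⟩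
  loopless := ⟨by
    rintro (_ | a) h
    · exact h
    · exact T.loopless.irrefl a h⟩

@[simp] theorem addLeaf_some_some (T : SimpleGraph V) (j a b : V) :
    (addLeaf T j).Adj (some a) (some b) ↔ T.Adj a b := Iff.rfl

@[simp] theorem addLeaf_none_some (T : SimpleGraph V) (j b : V) :
    (addLeaf T j).Adj none (some b) ↔ b = j := Iff.rfl

@[simp] theorem addLeaf_some_none (T : SimpleGraph V) (j a : V) :
    (addLeaf T j).Adj (some a) none ↔ a = j := Iff.rfl

/-- The edges `E` together with `k` copies of the edge from `j` to the leaf. -/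
def extendEdges (j : V) (E : Multiset (Sym2 V)) (k : ℕ) : Multiset (Sym2 (Option V)) :=
  E.map (Sym2.map some) + Multiset.replicate k s(none, some j)

theorem mem_extendEdges_some {j : V} {E : Multiset (Sym2 V)} {k : ℕ} {u x : V} :
    s(some u, some x) ∈ extendEdges j E k ↔ s(u, x) ∈ E := by
  have : s(some u, some x) = Sym2.map some s(u, x) := rfl
  simp only [extendEdges, Multiset.mem_add, Multiset.mem_replicate]
  rw [this, Multiset.mem_map_of_injective (Sym2.map.injective (Option.some_injective V))]
  simp

theorem none_mem_extendEdges {j : V} {E : Multiset (Sym2 V)} {k : ℕ} :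
    s(none, some j) ∈ extendEdges j E k ↔ k ≠ 0 := by
  simp only [extendEdges, Multiset.mem_add, Multiset.mem_replicate, Multiset.mem_map, and_true,
    or_iff_right_iff_imp, forall_exists_index, and_imp]
  intro e _ he
  induction e with
  | _ a b => simp at he

theorem extendEdges_eq_zero {j : V} {E : Multiset (Sym2 V)} {k : ℕ} :
    extendEdges j E k = 0 ↔ E = 0 ∧ k = 0 := by
  simp [extendEdges, ← Multiset.card_eq_zero]

variable [DecidableEq V]

theorem extendEdges_erase_some {j : V} {E : Multiset (Sym2 V)} {k : ℕ} {u x : V}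
    (h : s(u, x) ∈ E) :
    (extendEdges j E k).erase s(some u, some x) = extendEdges j (E.erase s(u, x)) k := by
  obtain ⟨F, rfl⟩ := Multiset.exists_cons_of_mem h
  simp [extendEdges]

theorem extendEdges_erase_none {j : V} {E : Multiset (Sym2 V)} {k : ℕ} :
    (extendEdges j E (k + 1)).erase s(none, some j) = extendEdges j E k := by
  rw [extendEdges, Multiset.replicate_succ, Multiset.add_cons, Multiset.erase_cons_head,
    extendEdges]

/-- The number of visits to `j` of a walk from `u` to `v` with edges `E`. -/
def visits (j u v : V) (E : Multiset (Sym2 V)) : ℕ :=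
  -- An interior visit to `j` uses two edges at `j`, a visit at either end of the walk only one; the
  -- indicators make up the difference.
  (E.countP (j ∈ ·) + (if u = j then 1 else 0) + (if v = j then 1 else 0)) / 2

theorem visits_erase_of_ne {j u v x : V} {E : Multiset (Sym2 V)} (hu : u ≠ j)
    (h : s(u, x) ∈ E) : visits j x v (E.erase s(u, x)) = visits j u v E := by
  obtain ⟨F, rfl⟩ := Multiset.exists_cons_of_mem h
  rw [Multiset.erase_cons_head, visits, visits, Multiset.countP_cons]
  simp only [Sym2.mem_iff, hu, hu.symm, false_or, if_false, @eq_comm _ j x]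
  rfl

theorem visits_erase_self {j v x : V} {E : Multiset (Sym2 V)} (hx : j ≠ x)
    (h : s(j, x) ∈ E) : visits j x v (E.erase s(j, x)) + 1 = visits j j v E := by
  obtain ⟨F, rfl⟩ := Multiset.exists_cons_of_mem h
  rw [Multiset.erase_cons_head, visits, visits, Multiset.countP_cons]
  simp only [Sym2.mem_iff, true_or, if_true, hx.symm, if_false]
  omega

variable [Fintype V]

theorem walkCount_addLeaf_none (T : SimpleGraph V) (j v : V) (E : Multiset (Sym2 V)) (k : ℕ) :
    walkCount (addLeaf T j) none (some v) (extendEdges j E (k + 1)) =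
      walkCount (addLeaf T j) (some j) (some v) (extendEdges j E k) := by
  classical
  rw [walkCount_rec, Fintype.sum_option, Finset.sum_eq_single j]
  · simp [none_mem_extendEdges, extendEdges_erase_none]
  · intro b _ hb
    simp [hb]
  · simp

open scoped Classical in
theorem walkCount_addLeaf_rec (T : SimpleGraph V) (j u v : V) (E : Multiset (Sym2 V)) (k : ℕ) :
    walkCount (addLeaf T j) (some u) (some v) (extendEdges j E (2 * k)) =
      (if (u = v ∧ E = 0) ∧ k = 0 then 1 else 0) +
      (if u = j ∧ k ≠ 0 then
        walkCount (addLeaf T j) (some j) (some v) (extendEdges j E (2 * (k - 1))) else 0) +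
      ∑ x, if T.Adj u x ∧ s(u, x) ∈ E then
        walkCount (addLeaf T j) (some x) (some v) (extendEdges j (E.erase s(u, x)) (2 * k))
        else 0 := by
  rw [walkCount_rec, Fintype.sum_option, ← add_assoc]
  congr 1
  · congr 1
    · simp [extendEdges_eq_zero, and_assoc]
    · by_cases hu : u = j
      · subst hu
        rw [Sym2.eq_swap]
        cases k with
        | zero => simp [none_mem_extendEdges]
        | succ k =>
          rw [show 2 * (k + 1) = 2 * k + 1 + 1 by ring, extendEdges_erase_none,
            walkCount_addLeaf_none]
          simp [none_mem_extendEdges]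
      · simp [hu]
  · refine Finset.sum_congr rfl fun x _ => ?_
    simp only [addLeaf_some_some, mem_extendEdges_some]
    split_ifs with h
    · rw [extendEdges_erase_some h.2]
    · rfl

/-- The walks that project to a given walk of `T` and make `k` excursions to the leaf arise by
distributing these excursions among the visits to its neighbour. -/
theorem walkCount_addLeaf (T : SimpleGraph V) (j u v : V) (E : Multiset (Sym2 V)) (k : ℕ) :
    walkCount (addLeaf T j) (some u) (some v) (extendEdges j E (2 * k)) =
      walkCount T u v E * Nat.multichoose (visits j u v E) k := by
  classical
  -- Every first step either uses up an edge of `E` or starts one of the `k` excursions.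
  induction hn : E.card + k using Nat.strong_induction_on generalizing u E k with
  | _ n ih =>
  have ihE : ∀ x, s(u, x) ∈ E →
      walkCount (addLeaf T j) (some x) (some v) (extendEdges j (E.erase s(u, x)) (2 * k)) =
      walkCount T x v (E.erase s(u, x)) *
        Nat.multichoose (visits j x v (E.erase s(u, x))) k := fun x hx =>
    ih _ (by
      rw [← hn, Multiset.card_erase_of_mem hx]
      have := Multiset.card_pos_iff_exists_mem.2 ⟨_, hx⟩
      simp only [Nat.pred_eq_sub_one]
      omega) x _ _ rfl
  rw [walkCount_addLeaf_rec]
  by_cases hu : u = j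
  · subst hu
    cases k with
    | zero =>
      rw [walkCount_rec T]
      simp only [and_true, ne_eq, not_true_eq_false, and_false, if_false, add_zero,
        Nat.multichoose_zero_right, mul_one]
      congr 1
      refine Finset.sum_congr rfl fun x _ => ?_
      split_ifs with h
      · rw [ihE x h.2, Nat.multichoose_zero_right, mul_one]
      · rfl
    | succ k =>
      have ihk := ih (E.card + k) (by omega) u E k rfl
      simp only [Nat.succ_ne_zero, and_false, if_false, ne_eq, not_false_eq_true, and_true,
        if_true, zero_add, Nat.add_sub_cancel, ihk]
      rcases hM : visits u u v E with _ | M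
      -- A walk starting at `j` visits `j`, so zero visits means that no walk has these edges and
      -- both sides vanish.
      · have hnone : ∀ x, ¬ (T.Adj u x ∧ s(u, x) ∈ E) := fun x hx => by
          have := visits_erase_self (v := v) hx.1.ne hx.2
          omega
        have h0 : walkCount T u v E = 0 := by
          rw [walkCount_rec]
          simp only [hnone, if_false, Finset.sum_const_zero, add_zero, ite_eq_right_iff,
            one_ne_zero, imp_false]
          rintro ⟨rfl, rfl⟩
          simp [visits] at hM
        simp [hnone, h0]
      -- Pascal's rule for multisets mirrors the choice at `j`: an excursion keeps the visits and
      -- lowers `k`, while a step inside `T` keeps `k` and uses up one visit.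
      · rw [Nat.multichoose_succ_succ, mul_add (walkCount T u v E),
          add_comm (_ * Nat.multichoose M (k + 1))]
        refine congrArg₂ _ rfl ?_
        rw [walkCount_rec T, add_mul _ _ (Nat.multichoose M (k + 1)), Finset.sum_mul]
        -- The trivial walk at `j` has one visit, so `M = 0` and no place remains for the `k + 1`
        -- excursions.
        have hb : (if u = v ∧ E = 0 then 1 else 0) * Nat.multichoose M (k + 1) = 0 := by
          split_ifs with h
          · obtain ⟨rfl, rfl⟩ := h
            obtain rfl : M = 0 := by simp [visits] at hM; omega
            simp
          · simp
        rw [hb, zero_add]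
        refine Finset.sum_congr rfl fun x _ => ?_
        split_ifs with h
        · rw [ihE x h.2]
          have := visits_erase_self (v := v) h.1.ne h.2
          rw [show visits u x v (E.erase s(u, x)) = M by omega]
        · simp
  · simp only [hu, false_and, if_false, add_zero]
    rw [walkCount_rec T, add_mul, Finset.sum_mul]
    congr 1
    · by_cases h : u = v ∧ E = 0
      · obtain ⟨rfl, rfl⟩ := h
        have : visits j u u 0 = 0 := by simp [visits, hu]
        rw [this]
        cases k <;> simp
      · simp [h]
    · refine Finset.sum_congr rfl fun x _ => ?_
      split_ifs with h
      · rw [ihE x h.2, visits_erase_of_ne hu h.2]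
      · simp

end AddLeaf

/-! ### Degrees, edges and acyclicity when a leaf is added. -/

section Trees

variable {V : Type*}

theorem degree_addLeaf_none [Fintype V] [DecidableEq V] (T : SimpleGraph V) (j : V)
    [Fintype ((addLeaf T j).neighborSet none)] :
    (addLeaf T j).degree none = 1 := by
  rw [SimpleGraph.degree_eq_one_iff_existsUnique_adj]
  refine ⟨some j, rfl, ?_⟩
  rintro (_ | b) h
  · exact h.elim
  · rw [show b = j from h]

open scoped Classical in
theorem degree_addLeaf_some [Fintype V] (T : SimpleGraph V) (j v : V) :
    (addLeaf T j).degree (some v) = T.degree v + if v = j then 1 else 0 := by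
  rw [← SimpleGraph.card_neighborFinset_eq_degree, ← SimpleGraph.card_neighborFinset_eq_degree,
    SimpleGraph.neighborFinset_eq_filter, SimpleGraph.neighborFinset_eq_filter,
    Finset.card_filter, Finset.card_filter, Fintype.sum_option, add_comm]
  simp

theorem comap_addLeaf (T : SimpleGraph V) (j : V) : (addLeaf T j).comap some = T := rfl

theorem eq_addLeaf {G : SimpleGraph (Option V)} {j : V} (h : ∀ x, G.Adj none (some x) ↔ x = j) :
    G = addLeaf (G.comap some) j := by
  ext a b
  rcases a with _ | a <;> rcases b with _ | b
  · simp
  · exact h b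
  · rw [G.adj_comm]; exact h a
  · rfl

theorem addLeaf_injective {T T' : SimpleGraph V} {j j' : V} (h : addLeaf T j = addLeaf T' j') :
    T = T' ∧ j = j' := by
  refine ⟨?_, ?_⟩
  · rw [← comap_addLeaf T j, h, comap_addLeaf]
  · have : (addLeaf T' j').Adj none (some j) := h ▸ rfl
    exact this

theorem exists_eq_addLeaf {G : SimpleGraph (Option V)} [Fintype (G.neighborSet none)]
    (h : G.degree none = 1) : ∃ j, G = addLeaf (G.comap some) j := by
  obtain ⟨x, hx, hu⟩ := SimpleGraph.degree_eq_one_iff_existsUnique_adj.1 h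
  cases x with
  | none => exact absurd hx (G.loopless.irrefl _)
  | some j =>
    refine ⟨j, eq_addLeaf fun x => ⟨fun hx => Option.some_injective _ (hu _ hx), ?_⟩⟩
    rintro rfl
    exact hx

open scoped Classical in
theorem edgeFinset_addLeaf [Fintype V] (T : SimpleGraph V) (j : V) :
    (addLeaf T j).edgeFinset.val = extendEdges j T.edgeFinset.val 1 := by
  have h : (addLeaf T j).edgeFinset =
      insert s(none, some j) (T.edgeFinset.image (Sym2.map some)) := by
    ext e
    induction e with
    | _ a b =>
      have key : ∀ a b : V, s(some a, some b) ∈ T.edgeFinset.image (Sym2.map some) ↔ T.Adj a b := by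
        intro a b
        rw [show s(some a, some b) = Sym2.map some s(a, b) from rfl,
          (Sym2.map.injective (Option.some_injective V)).mem_finset_image]
        simp
      have key' : ∀ b : Option V, s(none, b) ∉ T.edgeFinset.image (Sym2.map some) := by
        intro b hb
        obtain ⟨e, _, he⟩ := Finset.mem_image.1 hb
        induction e with
        | _ x y => simp at he
      rcases a with _ | a <;> rcases b with _ | b
      · simp [key']
      · simp [key']
      · rw [Sym2.eq_swap]; simp [key']
      · simp [key]
  have hn : s(none, some j) ∉ T.edgeFinset.image (Sym2.map some) := by
    intro hb
    obtain ⟨e, _, he⟩ := Finset.mem_image.1 hb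
    induction e with
    | _ x y => simp at he
  rw [h, Finset.insert_val_of_notMem hn, Finset.image_val_of_injOn
    (Sym2.map.injective (Option.some_injective V)).injOn]
  simp [extendEdges, add_comm]

open scoped Classical in
-- A tree is a connected graph with one more vertex than edges. A leaf raises both numbers by one,
-- so only connectedness has to be compared.
theorem isTree_addLeaf [Fintype V] (T : SimpleGraph V) (j : V) :
    (addLeaf T j).IsTree ↔ T.IsTree := by
  have hcard : (addLeaf T j).edgeFinset.card = T.edgeFinset.card + 1 := by
    rw [Finset.card_def, edgeFinset_addLeaf]
    simp [extendEdges]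
  have hconn : (addLeaf T j).Connected ↔ T.Connected := by
    constructor
    · intro h
      have h' := h.induce_compl_singleton_of_degree_eq_one (degree_addLeaf_none T j)
      let φ : (addLeaf T j).induce {none}ᶜ →g T :=
        { toFun := fun x => x.1.get (Option.isSome_iff_ne_none.2 x.2)
          map_rel' := by
            rintro ⟨_ | a, ha⟩ ⟨_ | b, hb⟩ hab
            · exact absurd rfl ha
            · exact absurd rfl ha
            · exact absurd rfl hb
            · exact hab }
      exact h'.map φ (fun v => ⟨⟨some v, by simp⟩, rfl⟩)
    · intro h
      have hs : ∀ a b, (addLeaf T j).Reachable (some a) (some b) := fun a b =>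
        (h a b).map (⟨some, fun h => h⟩ : T →g addLeaf T j)
      have hn : (addLeaf T j).Reachable none (some j) := SimpleGraph.Adj.reachable rfl
      have : ∀ a, (addLeaf T j).Reachable a (some j) := by
        rintro (_ | a)
        · exact hn
        · exact hs _ _
      exact ⟨fun a b => (this a).trans (this b).symm⟩
  rw [SimpleGraph.isTree_iff_connected_and_card, SimpleGraph.isTree_iff_connected_and_card, hconn]
  simp only [Nat.card_eq_fintype_card, ← SimpleGraph.edgeFinset_card, hcard,
    Fintype.card_option, Nat.add_right_cancel_iff]

end Trees

/-! ### Counting tours -/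

section TourCount

open scoped Classical in
-- A walk uses no edges outside the graph, so the multiplicities on its edges determine the whole
-- multiset.
theorem tourCount_eq_walkCount {V : Type*} [Fintype V] [DecidableEq V] (T : SimpleGraph V) (m : ℕ)
    (v : V) : tourCount T m v = walkCount T v v ((2 * m) • T.edgeFinset.val) := by
  refine Nat.card_congr (Equiv.subtypeEquivRight fun w => ?_)
  rw [Multiset.ext]
  refine forall_congr' fun e => ?_
  rw [Multiset.coe_count, Multiset.count_nsmul]
  by_cases he : e ∈ T.edgeSet
  · rw [Multiset.count_eq_one_of_mem T.edgeFinset.nodup (by simpa using he)]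
    simp only [he, true_imp_iff, mul_one]
  · rw [Multiset.count_eq_zero_of_notMem (by simpa using he),
      List.count_eq_zero_of_not_mem fun h => he (w.edges_subset_edgeSet h)]
    simp [he]

open scoped Classical in
-- A tour meets `2m * deg j` edges at `j`, so it visits `j` exactly `m * deg j` times, and once more
-- if it begins there.
theorem tourCount_addLeaf {V : Type*} [Fintype V] [DecidableEq V] (T : SimpleGraph V) (m : ℕ)
    (j v : V) : tourCount (addLeaf T j) m (some v) =
      tourCount T m v * Nat.multichoose (T.degree j * m + if v = j then 1 else 0) m := by
  have h1 : (2 * m) • (addLeaf T j).edgeFinset.val =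
      extendEdges j ((2 * m) • T.edgeFinset.val) (2 * m) := by
    rw [edgeFinset_addLeaf, extendEdges, extendEdges, nsmul_add, Multiset.map_nsmul,
      Multiset.nsmul_replicate, mul_one]
  have h2 : T.edgeFinset.val.countP (j ∈ ·) = T.degree j := by
    rw [← SimpleGraph.card_incidenceFinset_eq_degree, SimpleGraph.incidenceFinset_eq_filter,
      Finset.card_def, Finset.filter_val, Multiset.countP_eq_card_filter]
  rw [tourCount_eq_walkCount, tourCount_eq_walkCount, h1, walkCount_addLeaf, visits,
    Multiset.countP_nsmul, h2]
  congr 2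
  rw [mul_assoc, mul_comm m]
  split_ifs <;> omega

end TourCount

/-! ### The product formula for the number of tours. -/

section TourProduct

universe u

open scoped Classical in
/-- A graph with a leaf `l` is obtained by adding a leaf to the graph on the other vertices. -/
theorem exists_iso_addLeaf {V : Type u} [Fintype V] [DecidableEq V] {T : SimpleGraph V} {l : V}
    (hl : T.degree l = 1) :
    ∃ (T' : SimpleGraph {x // x ≠ l}) (j : {x // x ≠ l}) (φ : addLeaf T' j ≃g T), φ none = l := by
  let e : Option {x // x ≠ l} ≃ V := Equiv.optionSubtypeNe l
  let ψ : T.comap e ≃g T := SimpleGraph.Iso.comap e T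
  have hn : ψ none = l := Equiv.optionSubtypeNe_none l
  obtain ⟨j, hj⟩ := exists_eq_addLeaf (G := T.comap e) (by rw [← ψ.degree_eq none, hn, hl])
  refine ⟨(T.comap e).comap some, j, ⟨e, fun {a b} => ?_⟩, hn⟩
  rw [← hj]
  rfl

open scoped Classical in
theorem tourCount_eq_prod {V : Type u} [Fintype V] [DecidableEq V] {T : SimpleGraph V}
    (hT : T.IsTree) (m : ℕ) (v : V) : tourCount T (m + 1) v =
      ∏ u, if u = v then rootExitCount m (T.degree u) else exitCount m (T.degree u - 1) := by
  induction hn : Fintype.card V generalizing V with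
  | zero => exact ((Fintype.card_eq_zero_iff.1 hn).false v).elim
  | succ n ih =>
    rcases subsingleton_or_nontrivial V with hV | hV
    · have h0 : ∀ u, T.degree u = 0 := fun u => by
        rw [SimpleGraph.degree_eq_zero]
        intro w hw
        exact hw.ne (Subsingleton.elim _ _)
      have : T = ⊥ := by
        ext a b
        simpa using fun h : T.Adj a b => h.ne (Subsingleton.elim _ _)
      have hE : T.edgeFinset.val = 0 := by rw [Finset.val_eq_zero]; simp [this]
      rw [tourCount_eq_walkCount, hE, smul_zero, walkCount_rec]
      simp [Subsingleton.elim _ v, rootExitCount]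
    -- A nontrivial tree has two leaves, so one of them is not the beginning of the tours.
    · obtain ⟨l, hlv, hl⟩ : ∃ l, v ≠ l ∧ T.degree l = 1 := by
        obtain ⟨a, b, hab, ha, hb⟩ := hT.exists_ne_and_degree_eq_one
        by_cases h : v = a
        · exact ⟨b, h ▸ hab, hb⟩
        · exact ⟨a, h, ha⟩
      obtain ⟨T', j, φ, hφ⟩ := exists_iso_addLeaf hl
      have hT' : T'.IsTree := by rwa [← isTree_addLeaf T' j, φ.isTree_iff]
      obtain ⟨w, rfl⟩ : ∃ w, φ (some w) = v := by
        obtain ⟨_ | w, hw⟩ := φ.surjective v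
        · exact absurd (hw.symm.trans hφ) hlv
        · exact ⟨w, hw⟩
      have hcard : Fintype.card {x // x ≠ l} = n := by
        rw [Fintype.card_subtype_compl, hn]; simp
      have hprod := Fintype.prod_equiv φ.toEquiv
        (fun u => if u = some w then rootExitCount m ((addLeaf T' j).degree u)
          else exitCount m ((addLeaf T' j).degree u - 1))
        (fun u => if u = φ (some w) then rootExitCount m (T.degree u)
          else exitCount m (T.degree u - 1)) (fun u => by
            have : T.degree (φ.toEquiv u) = (addLeaf T' j).degree u := φ.degree_eq u
            simp only [this]
            have h : φ.toEquiv u = φ (some w) ↔ u = some w := φ.injective.eq_iff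
            simp only [h])
      rw [← tourCount_iso φ, ← hprod, tourCount_addLeaf, ih hT' w hcard, Fintype.prod_option,
        if_neg (show none ≠ some w by simp), degree_addLeaf_none]
      simp only [Nat.sub_self, exitCount, degree_addLeaf_some, one_mul, Option.some.injEq]
      -- Only the factor at the neighbour `j` of the leaf changes, by one step of the recursion of
      -- `rootExitCount` or `exitCount`.
      rw [← Finset.mul_prod_erase _ _ (Finset.mem_univ j),
        ← Finset.mul_prod_erase _ _ (Finset.mem_univ j), mul_right_comm]
      congr 1
      · by_cases hjw : j = w
        · subst hjw
          simp [rootExitCount]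
        -- Nontriviality gives `j` positive degree in `T'`, so that the subtraction in `T'.degree j
        -- - 1` does not truncate.
        · have : Nontrivial {x // x ≠ l} := ⟨⟨j, w, hjw⟩⟩
          have hpos := hT'.connected.preconnected.degree_pos_of_nontrivial j
          obtain ⟨d, hd⟩ : ∃ d, T'.degree j = d + 1 := ⟨T'.degree j - 1, by omega⟩
          simp [hjw, Ne.symm hjw, hd, exitCount]
      · refine Finset.prod_congr rfl fun u hu => ?_
        rw [if_neg (Finset.ne_of_mem_erase hu), add_zero]

open scoped Classical in
/-- The number of tours of a tree, in terms of its degrees. -/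
theorem tourCount_eq {V : Type u} [Fintype V] [DecidableEq V] [Nontrivial V] {T : SimpleGraph V}
    (hT : T.IsTree) (m : ℕ) (v : V) :
    tourCount T (m + 1) v = T.degree v * ∏ u, exitCount m (T.degree u - 1) := by
  rw [tourCount_eq_prod hT, ← Finset.mul_prod_erase _ _ (Finset.mem_univ v), if_pos rfl,
    ← Finset.mul_prod_erase _ (fun u => exitCount m (T.degree u - 1)) (Finset.mem_univ v),
    ← mul_assoc]
  have hpos := hT.connected.preconnected.degree_pos_of_nontrivial v
  obtain ⟨d, hd⟩ : ∃ d, T.degree v = d + 1 := ⟨T.degree v - 1, by omega⟩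
  congr 1
  · rw [hd, rootExitCount_succ, Nat.add_sub_cancel]
  · exact Finset.prod_congr rfl fun u hu => if_neg (Finset.ne_of_mem_erase hu)

open scoped Classical in
theorem sum_tourCount_eq {V : Type u} [Fintype V] [DecidableEq V] [Nontrivial V]
    {T : SimpleGraph V} (hT : T.IsTree) (m : ℕ) :
    ∑ v, tourCount T (m + 1) v =
      2 * (Fintype.card V - 1) * ∏ u, exitCount m (T.degree u - 1) := by
  simp_rw [tourCount_eq hT, ← Finset.sum_mul, SimpleGraph.sum_degrees_eq_twice_card_edges]
  rw [← hT.card_edgeFinset, Nat.add_sub_cancel]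

end TourProduct

/-! ### Counting trees with given degrees -/

section DegreeSequences

universe u

open scoped Classical in
/-- The number of trees on `V` in which each vertex `v` has degree `d v`. -/
def treeCount {V : Type u} [Fintype V] (d : V → ℕ) : ℕ :=
  Nat.card {T : SimpleGraph V // T.IsTree ∧ ∀ v, T.degree v = d v}

theorem treeCount_comp {V W : Type u} [Fintype V] [Fintype W] (e : W ≃ V) (d : V → ℕ) :
    treeCount (d ∘ e) = treeCount d := by
  classical
  refine Nat.card_congr (Equiv.subtypeEquiv e.simpleGraph fun T => ?_)
  let φ : e.simpleGraph T ≃g T := SimpleGraph.Iso.comap e.symm T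
  rw [φ.isTree_iff]
  refine and_congr Iff.rfl ⟨fun h v => ?_, fun h w => ?_⟩
  · rw [← φ.degree_eq v]
    exact (h (e.symm v)).trans (by simp)
  · have := φ.degree_eq (e w)
    rw [h] at this
    rw [Function.comp_apply, ← this]
    rw [show φ (e w) = w from e.symm_apply_apply w]

open scoped Classical in
theorem treeCount_option {V : Type u} [Fintype V] (d : Option V → ℕ) (h : d none = 1) :
    treeCount d = ∑ j : V, Nat.card {T : SimpleGraph V // T.IsTree ∧
      ∀ v, T.degree v + (if v = j then 1 else 0) = d (some v)} := by
  rw [← Nat.card_sigma]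
  have hdeg : ∀ p : Σ j : V, {T : SimpleGraph V // T.IsTree ∧
      ∀ v, T.degree v + (if v = j then 1 else 0) = d (some v)},
      ∀ v, (addLeaf p.2.1 p.1).degree v = d v := by
    rintro p (_ | v)
    · rw [degree_addLeaf_none, h]
    · rw [degree_addLeaf_some, p.2.2.2 v]
  refine Nat.card_congr (Equiv.ofBijective (fun p => ⟨addLeaf p.2.1 p.1,
    (isTree_addLeaf _ _).2 p.2.2.1, hdeg p⟩) ⟨?_, ?_⟩).symm
  · rintro ⟨j, T, hT⟩ ⟨j', T', hT'⟩ h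
    obtain ⟨rfl, rfl⟩ := addLeaf_injective (congrArg Subtype.val h)
    rfl
  · rintro ⟨G, hG, hd⟩
    obtain ⟨j, hj⟩ := exists_eq_addLeaf ((hd none).trans h)
    generalize G.comap some = T at hj
    subst hj
    refine ⟨⟨j, T, (isTree_addLeaf _ _).1 hG, fun v => ?_⟩, rfl⟩
    rw [← hd, degree_addLeaf_some]

/-- Induction by removing a prescribed leaf: if it hangs at `j`, the remaining trees contribute `d j
* n!` after multiplication by the factorials, and `∑ j, d j = n + 1` gives `(n + 1)!`. -/
theorem treeCount_mul_prod_factorial {V : Type u} [Fintype V] (n : ℕ)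
    (hV : Fintype.card V = n + 2) (d : V → ℕ) (hd : ∑ v, d v = n) :
    treeCount (fun v => d v + 1) * ∏ v, (d v).factorial = n.factorial := by
  classical
  induction n generalizing V with
  | zero =>
    have h0 : ∀ v, d v = 0 := fun v => Finset.sum_eq_zero_iff.1 hd v (Finset.mem_univ v)
    obtain ⟨l⟩ : Nonempty V := Fintype.card_pos_iff.1 (by omega)
    have hc : Fintype.card {x // x ≠ l} = 1 := by
      rw [Fintype.card_subtype_compl, hV]; simp
    obtain ⟨j, hj⟩ := Fintype.card_eq_one_iff.1 hc
    have : Unique {x // x ≠ l} := ⟨⟨j⟩, hj⟩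
    rw [← treeCount_comp (Equiv.optionSubtypeNe l), treeCount_option _ (by simp [h0])]
    simp only [h0, Function.comp_apply, Nat.factorial_zero, Finset.prod_const_one, mul_one,
      Fintype.sum_unique]
    rw [Nat.card_eq_one_iff_unique]
    have hsub : ∀ T T' : SimpleGraph {x // x ≠ l}, T = T' := fun T T' => by
      ext a b
      exact ⟨fun h => absurd (Subsingleton.elim a b) h.ne,
        fun h => absurd (Subsingleton.elim a b) h.ne⟩
    refine ⟨⟨fun T T' => Subtype.ext (hsub _ _)⟩, ⟨⊥, .of_subsingleton, fun v => ?_⟩⟩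
    simp [Subsingleton.elim v default]
  | succ n ih =>
    -- The `n + 3` values of `d` sum to only `n + 1`, so one of them is zero.
    obtain ⟨l, hl⟩ : ∃ l, d l = 0 := by
      by_contra! h
      have : ∑ v : V, 1 ≤ ∑ v, d v :=
        Finset.sum_le_sum fun v _ => Nat.one_le_iff_ne_zero.2 (h v)
      simp [hd, hV] at this
    have hc : Fintype.card {x // x ≠ l} = n + 2 := by
      rw [Fintype.card_subtype_compl, hV]; simp
    have : Nontrivial {x // x ≠ l} := Fintype.one_lt_card_iff_nontrivial.1 (by omega)
    set e := Equiv.optionSubtypeNe l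
    set d' : {x // x ≠ l} → ℕ := fun x => d x with hd'
    have hsum : ∑ x, d' x = n + 1 := by
      rw [← hd, ← Fintype.sum_equiv e (fun x => d (e x)) d (fun _ => rfl), Fintype.sum_option]
      simp [e, hl, hd']
    have hprod : ∏ v, (d v).factorial = ∏ x, (d' x).factorial := by
      rw [← Fintype.prod_equiv e (fun x => (d (e x)).factorial) _ (fun _ => rfl),
        Fintype.prod_option]
      simp [e, hl, hd']
    rw [← treeCount_comp e, treeCount_option _ (by simp [e, hl]), Finset.sum_mul, hprod]
    have key : ∀ j, Nat.card {T : SimpleGraph {x // x ≠ l} // T.IsTree ∧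
        ∀ v, T.degree v + (if v = j then 1 else 0) = d' v + 1} * ∏ x, (d' x).factorial =
        d' j * n.factorial := by
      intro j
      rcases hj : d' j with _ | k
      -- If `d' j = 0`, then `j` would be isolated once the leaf is removed, although at least two
      -- vertices remain.
      · have : IsEmpty {T : SimpleGraph {x // x ≠ l} // T.IsTree ∧
            ∀ v, T.degree v + (if v = j then 1 else 0) = d' v + 1} := ⟨fun ⟨T, hT, h⟩ => by
          have := h j
          have := hT.connected.preconnected.degree_pos_of_nontrivial j
          simp only [if_true] at *
          omega⟩
        rw [Nat.card_of_isEmpty, zero_mul, zero_mul]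
      · have hup : ∀ x, d' x = Function.update d' j k x + if x = j then 1 else 0 := fun x => by
          by_cases hx : x = j
          · subst hx; simp [hj]
          · simp [hx]
        have hs : ∑ x, Function.update d' j k x = n := by
          have := hsum
          rw [Finset.sum_congr rfl fun x _ => hup x, Finset.sum_add_distrib] at this
          simpa using this
        have hp : ∏ x, (d' x).factorial =
            (k + 1) * ∏ x, (Function.update d' j k x).factorial := by
          rw [← Finset.mul_prod_erase _ _ (Finset.mem_univ j),
            ← Finset.mul_prod_erase _ (fun x => (Function.update d' j k x).factorial)
              (Finset.mem_univ j), hj, Function.update_self, ← mul_assoc, Nat.factorial_succ]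
          congr 1
          exact Finset.prod_congr rfl fun x hx => by
            rw [Function.update_of_ne (Finset.ne_of_mem_erase hx)]
        have hcount : Nat.card {T : SimpleGraph {x // x ≠ l} // T.IsTree ∧
            ∀ v, T.degree v + (if v = j then 1 else 0) = d' v + 1} =
            treeCount fun x => Function.update d' j k x + 1 := by
          refine Nat.card_congr (Equiv.subtypeEquivRight fun T => and_congr Iff.rfl
            (forall_congr' fun x => ?_))
          rw [hup x]
          dsimp only
          omega
        rw [hcount, hp, mul_left_comm, ih hc _ hs]
    have := Finset.sum_congr rfl fun j (_ : j ∈ Finset.univ) => key j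
    rw [← Finset.sum_mul _ d', hsum, ← Nat.factorial_succ] at this
    have he : ∀ v, e (some v) = v := fun v => Equiv.optionSubtypeNe_some l v
    simp only [Function.comp_apply, he]
    convert this

open scoped Classical in
/-- The sum over all trees of a product of weights that depend on the degrees. -/
theorem sum_trees_prod {V : Type u} [Fintype V] (n : ℕ) (hV : Fintype.card V = n + 2)
    (w : ℕ → ℚ) :
    ∑ T : {T : SimpleGraph V // T.IsTree}, ∏ v, w (T.1.degree v - 1) =
      n.factorial *
        PowerSeries.coeff n ((PowerSeries.mk fun d => w d / d.factorial) ^ (n + 2)) := by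
  have : Nontrivial V := Fintype.one_lt_card_iff_nontrivial.1 (by omega)
  have hpow : (PowerSeries.mk fun d => w d / d.factorial) ^ (n + 2) =
      ∏ _v : V, (PowerSeries.mk fun d => w d / d.factorial) := by
    rw [Finset.prod_const, Finset.card_univ, hV]
  have hpos : ∀ T : {T : SimpleGraph V // T.IsTree}, ∀ v, T.1.degree v - 1 + 1 = T.1.degree v :=
    fun T v => Nat.sub_add_cancel (T.2.connected.preconnected.degree_pos_of_nontrivial v)
  -- The trees are grouped by the sequence of degrees minus one, whose sum is `2(n + 1) - (n + 2) =
  -- n`; these sequences also index the expansion of the coefficient of the power.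
  have hmem : ∀ T : {T : SimpleGraph V // T.IsTree},
      Finsupp.equivFunOnFinite.symm (fun v => T.1.degree v - 1) ∈
        (Finset.univ : Finset V).finsuppAntidiag n := by
    intro T
    rw [Finset.mem_finsuppAntidiag]
    refine ⟨?_, by simp⟩
    have h1 := T.1.sum_degrees_eq_twice_card_edges
    have h2 := T.2.card_edgeFinset
    rw [← Finset.sum_congr rfl fun v _ => hpos T v, Finset.sum_add_distrib] at h1
    simp only [Finset.sum_const, Finset.card_univ, smul_eq_mul, mul_one] at h1
    simp only [Finsupp.coe_equivFunOnFinite_symm]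
    omega
  rw [hpow, PowerSeries.coeff_prod, Finset.mul_sum,
    ← Finset.sum_fiberwise_of_maps_to (fun T _ => hmem T)]
  refine Finset.sum_congr rfl fun d hd => ?_
  obtain ⟨hd, -⟩ := Finset.mem_finsuppAntidiag.1 hd
  have hcount := treeCount_mul_prod_factorial n hV d hd
  have hiff : ∀ T : {T : SimpleGraph V // T.IsTree},
      Finsupp.equivFunOnFinite.symm (fun v => T.1.degree v - 1) = d ↔
        ∀ v, T.1.degree v = d v + 1 := by
    intro T
    rw [Finsupp.ext_iff]
    refine forall_congr' fun v => ?_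
    have := hpos T v
    simp only [Finsupp.coe_equivFunOnFinite_symm]
    omega
  have hcard : (Finset.univ.filter fun T : {T : SimpleGraph V // T.IsTree} =>
      Finsupp.equivFunOnFinite.symm (fun v => T.1.degree v - 1) = d).card =
      treeCount fun v => d v + 1 := by
    rw [treeCount, ← Fintype.card_subtype, ← Nat.card_eq_fintype_card]
    exact Nat.card_congr ((Equiv.subtypeEquivRight hiff).trans
      (Equiv.subtypeSubtypeEquivSubtypeInter _
        fun T : SimpleGraph V => ∀ v, T.degree v = d v + 1))
  rw [Finset.sum_congr rfl (g := fun _ => ∏ v, w (d v)) fun T hT => ?_, Finset.sum_const, hcard]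
  · simp only [PowerSeries.coeff_mk, Finset.prod_div_distrib, nsmul_eq_mul]
    rw [← hcount]
    have hne : (∏ v, ((d v).factorial : ℚ)) ≠ 0 :=
      Finset.prod_ne_zero_iff.2 fun v _ => by exact_mod_cast (d v).factorial_ne_zero
    push_cast
    field_simp
  · have := (hiff T).1 (Finset.mem_filter.1 hT).2
    simp [this]

end DegreeSequences

/-! ### From unlabeled to labeled trees -/

section Labeled

/-- The labelings of a graph: permutations of the vertices correspond to isomorphisms to
a graph on the same vertices. -/
def permEquivIso {k : ℕ} (G : {G : SimpleGraph (Fin k) // G.IsTree}) :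
    Equiv.Perm (Fin k) ≃
      Σ H : {H : {G : SimpleGraph (Fin k) // G.IsTree} // (treeSetoid k).r H G}, H.1.1 ≃g G.1 where
  toFun σ := ⟨⟨⟨G.1.comap σ, (SimpleGraph.Iso.comap σ G.1).isTree_iff.2 G.2⟩,
    ⟨SimpleGraph.Iso.comap σ G.1⟩⟩, SimpleGraph.Iso.comap σ G.1⟩
  invFun p := p.2.toEquiv
  left_inv σ := by ext; rfl
  right_inv := by
    rintro ⟨⟨⟨H, hH⟩, hr⟩, φ⟩
    obtain ⟨σ, hσ⟩ := φ
    have hφ : H = G.1.comap σ := by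
      ext a b
      exact hσ.symm
    subst hφ
    rfl

/-- Orbit-stabilizer: relabelings are sorted by the graph they produce, and each such graph has as
many isomorphisms to `G` as `G` has automorphisms. -/
theorem card_isoClass {k : ℕ} (G : {G : SimpleGraph (Fin k) // G.IsTree}) :
    Nat.card {H : {G : SimpleGraph (Fin k) // G.IsTree} // (treeSetoid k).r H G} *
      Nat.card (G.1 ≃g G.1) = k.factorial := by
  have h := Nat.card_congr (permEquivIso G)
  have hfin : ∀ H : SimpleGraph (Fin k), Finite (H ≃g G.1) := fun H =>
    Finite.of_injective (fun φ => φ.toEquiv) RelIso.toEquiv_injective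
  have hc : ∀ H : {H : {G : SimpleGraph (Fin k) // G.IsTree} // (treeSetoid k).r H G},
      Nat.card (H.1.1 ≃g G.1) = Nat.card (G.1 ≃g G.1) := by
    rintro ⟨H, ⟨φ⟩⟩
    exact Nat.card_congr
      { toFun := fun α => φ.symm.trans α
        invFun := fun β => φ.trans β
        left_inv := fun α => by ext x; simp
        right_inv := fun β => by ext x; simp }
  have := Fintype.ofFinite {H : {G : SimpleGraph (Fin k) // G.IsTree} // (treeSetoid k).r H G}
  have := fun H : {H : {G : SimpleGraph (Fin k) // G.IsTree} // (treeSetoid k).r H G} =>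
    hfin H.1.1
  rw [Nat.card_sigma, Nat.card_perm, Nat.card_fin] at h
  simp only [hc, Finset.sum_const, Finset.card_univ, smul_eq_mul] at h
  rw [h, Nat.card_eq_fintype_card]

/-- The isomorphism class of a tree. -/
def UnlabeledTree.mk {k : ℕ} (T : {T : SimpleGraph (Fin k) // T.IsTree}) : UnlabeledTree k :=
  Quotient.mk (treeSetoid k) T

theorem UnlabeledTree.mk_surjective {k : ℕ} :
    Function.Surjective (UnlabeledTree.mk : _ → UnlabeledTree k) :=
  Quotient.mk_surjective

theorem UnlabeledTree.mk_eq_mk {k : ℕ} {T T' : {T : SimpleGraph (Fin k) // T.IsTree}} :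
    UnlabeledTree.mk T = UnlabeledTree.mk T' ↔ (treeSetoid k).r T T' :=
  Quotient.eq (r := treeSetoid k)

theorem UnlabeledTree.weight_mk {k : ℕ} (m : ℕ) (T : {T : SimpleGraph (Fin k) // T.IsTree}) :
    (UnlabeledTree.mk T).weight m = graphWeight m T.1 := rfl

open scoped Classical in
-- A class contains `(n + 1)! / |Γ(T)|` labeled trees, so the weights `1 / |Γ(T)|` become a uniform
-- `1 / (n + 1)!` over labeled trees.
theorem hyperCatalan_mul_factorial (m n : ℕ) :
    hyperCatalan m n * (n + 1).factorial =
      ∑ T : {T : SimpleGraph (Fin (n + 1)) // T.IsTree}, ∑ v, (tourCount T.1 m v : ℚ) := by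
  rw [hyperCatalan, Finset.sum_mul,
    ← Finset.sum_fiberwise (s := Finset.univ) (g := UnlabeledTree.mk)]
  refine Finset.sum_congr rfl fun q _ => ?_
  obtain ⟨G, rfl⟩ := UnlabeledTree.mk_surjective q
  have hpos : (Nat.card (G.1 ≃g G.1) : ℚ) ≠ 0 := by
    have := card_isoClass G
    have h0 := Nat.factorial_ne_zero (n + 1)
    rw [← this] at h0
    exact_mod_cast right_ne_zero_of_mul h0
  have hconst : ∀ T ∈ Finset.univ.filter (UnlabeledTree.mk · = UnlabeledTree.mk G),
      ∑ v, (tourCount T.1 m v : ℚ) = ∑ v, (tourCount G.1 m v : ℚ) := by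
    intro T hT
    obtain ⟨φ⟩ := UnlabeledTree.mk_eq_mk.1 (Finset.mem_filter.1 hT).2
    exact Fintype.sum_equiv φ.toEquiv _ _ fun v => by rw [tourCount_iso φ]; rfl
  have hcard : (Finset.univ.filter (UnlabeledTree.mk · = UnlabeledTree.mk G)).card =
      Nat.card {H : {G : SimpleGraph (Fin (n + 1)) // G.IsTree} //
        (treeSetoid (n + 1)).r H G} := by
    rw [← Fintype.card_subtype, ← Nat.card_eq_fintype_card]
    exact Nat.card_congr (Equiv.subtypeEquivRight fun T => UnlabeledTree.mk_eq_mk)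
  rw [Finset.sum_congr rfl hconst, Finset.sum_const, hcard, nsmul_eq_mul, ← card_isoClass G,
    UnlabeledTree.weight_mk, graphWeight, ← Finset.sum_div]
  push_cast
  field_simp

end Labeled

/-! ### The generating function -/

/-- The one-vertex tree has only the trivial tour. It is treated apart because `sum_tourCount_eq`
needs at least two vertices. -/
theorem hyperCatalan_zero (m : ℕ) : hyperCatalan (m + 1) 0 = 1 := by
  classical
  have h := hyperCatalan_mul_factorial (m + 1) 0
  have : Subsingleton (Fin (0 + 1)) := inferInstanceAs (Subsingleton (Fin 1))
  have hsub : ∀ T T' : SimpleGraph (Fin 1), T = T' := fun T T' => by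
    ext a b
    exact ⟨fun h => absurd (Subsingleton.elim a b) h.ne,
      fun h => absurd (Subsingleton.elim a b) h.ne⟩
  have : Unique {T : SimpleGraph (Fin (0 + 1)) // T.IsTree} :=
    ⟨⟨⟨⊥, .of_subsingleton⟩⟩, fun T => Subtype.ext (hsub _ _)⟩
  have hT : ∀ T : {T : SimpleGraph (Fin (0 + 1)) // T.IsTree}, ∀ v,
      tourCount T.1 (m + 1) v = 1 := fun T v => by
    rw [tourCount_eq_prod T.2]
    have h0 : T.1.degree v = 0 := by
      rw [SimpleGraph.degree_eq_zero]
      intro w hw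
      exact hw.ne (Subsingleton.elim _ _)
    rw [Finset.prod_eq_one]
    intro u _
    obtain rfl : u = v := Subsingleton.elim _ _
    rw [if_pos rfl, h0, rootExitCount]
  simpa [hT] using h

theorem hyperCatalan_succ (m n : ℕ) :
    ((n + 2 : ℕ) : ℚ) * hyperCatalan (m + 1) (n + 1) =
      2 * (PowerSeries.coeff n (ell (m + 1) ^ (n + 2)) : ℤ) := by
  classical
  have h := hyperCatalan_mul_factorial (m + 1) (n + 1)
  have hs : ∀ T : {T : SimpleGraph (Fin (n + 1 + 1)) // T.IsTree},
      ∑ v, (tourCount T.1 (m + 1) v : ℚ) =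
        2 * (n + 1) * ∏ u, (exitCount m (T.1.degree u - 1) : ℚ) := fun T => by
    rw [← Nat.cast_sum, sum_tourCount_eq T.2, Fintype.card_fin]
    push_cast
    simp
  -- The factorial in `exitCount_eq` cancels the one from the count of trees with given degrees.
  have hell : (PowerSeries.mk fun d => (exitCount m d : ℚ) / d.factorial) =
      PowerSeries.map (Int.castRingHom ℚ) (ell (m + 1)) := by
    ext d
    have : (d.factorial : ℚ) ≠ 0 := by exact_mod_cast d.factorial_ne_zero
    rw [PowerSeries.coeff_mk, PowerSeries.coeff_map, coeff_ell, exitCount_eq]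
    push_cast
    field_simp
    simp
  have ht : ∑ T : {T : SimpleGraph (Fin (n + 1 + 1)) // T.IsTree},
      ∏ u, (exitCount m (T.1.degree u - 1) : ℚ) = n.factorial *
        PowerSeries.coeff n ((PowerSeries.mk fun d => (exitCount m d : ℚ) / d.factorial) ^
          (n + 2)) := by
    convert sum_trees_prod n (Fintype.card_fin _) (fun d => (exitCount m d : ℚ))
  rw [Finset.sum_congr rfl fun T _ => hs T, ← Finset.mul_sum, ht, hell, ← map_pow,
    PowerSeries.coeff_map, Nat.factorial_succ, Nat.factorial_succ] at h
  have hn : (n.factorial : ℚ) ≠ 0 := by exact_mod_cast n.factorial_ne_zero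
  have hn' : (n + 1 : ℚ) ≠ 0 := by positivity
  refine mul_right_cancel₀ (mul_ne_zero hn' hn) ?_
  simp only [eq_intCast] at h
  push_cast at h ⊢
  linear_combination h

theorem catalanSeries_eq {m : ℕ} {f : ℤ⟦X⟧}
    (hf : f = PowerSeries.X * PowerSeries.subst f (ell (m + 1))) :
    catalanSeries (m + 1) = PowerSeries.map (Int.castRingHom ℚ) (PowerSeries.X + f ^ 2) := by
  have h0 : PowerSeries.X ∣ f := ⟨_, hf⟩
  have hX2 : (PowerSeries.X : ℤ⟦X⟧) ^ 2 ∣ f ^ 2 := pow_dvd_pow_of_dvd h0 2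
  rw [PowerSeries.X_pow_dvd_iff] at hX2
  ext n
  rw [catalanSeries, PowerSeries.coeff_mk, PowerSeries.coeff_map, map_add]
  match n with
  | 0 => simp [catalanCoeff, hX2 0]
  | 1 => simp [catalanCoeff, hX2 1, hyperCatalan_zero]
  | n + 2 =>
    -- The argument `1` selects the square of `f`; the resulting factor `k + 1 = 2` matches the one
    -- from summing degrees.
    have hL := PowerSeries.lagrange_inversion_pow (constantCoeff_ell m) hf n 1
    have hC := hyperCatalan_succ m n
    rw [PowerSeries.coeff_X, if_neg (by omega), zero_add, catalanCoeff]
    have hL' := congrArg (Int.cast : ℤ → ℚ) hL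
    have hn : ((n + 2 : ℕ) : ℚ) ≠ 0 := by positivity
    refine mul_left_cancel₀ hn ?_
    rw [hC, eq_intCast]
    push_cast at hL' ⊢
    linear_combination -hL'

end HypergraphCatalan

end

theorem mainTheorem4 (m : ℕ) (hm : 1 ≤ m) :
    (∃! f : ℤ⟦X⟧, f = PowerSeries.X * PowerSeries.subst f (HypergraphCatalan.ell m)) ∧
    ∀ f : ℤ⟦X⟧, f = PowerSeries.X * PowerSeries.subst f (HypergraphCatalan.ell m) →
      HypergraphCatalan.catalanSeries m =
        PowerSeries.map (Int.castRingHom ℚ)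
          (PowerSeries.X * PowerSeries.subst f (HypergraphCatalan.hSeries m)) := by
  obtain ⟨m, rfl⟩ : ∃ k, m = k + 1 := ⟨m - 1, by omega⟩
  refine ⟨PowerSeries.existsUnique_eq_X_mul_subst (HypergraphCatalan.constantCoeff_ell m),
    fun f hf => ?_⟩
  have h0 : PowerSeries.constantCoeff f = 0 := by rw [hf]; simp
  have hs : PowerSeries.HasSubst f := PowerSeries.HasSubst.of_constantCoeff_zero' h0
  -- `X * h(f) = X + f * (X * ℓ(f))`, and the equation for `f` turns the last product into `f ^ 2`.
  rw [HypergraphCatalan.catalanSeries_eq hf, HypergraphCatalan.hSeries_eq,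
    PowerSeries.subst_add hs, PowerSeries.subst_mul hs, PowerSeries.subst_X hs,
    ← PowerSeries.coe_substAlgHom hs, map_one, PowerSeries.coe_substAlgHom hs, mul_add,
    mul_left_comm, ← hf, mul_one, sq]
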